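/- All logarithms are to base $2$. For a density operator $\rho$ on a finite-dimensional space let $H(\rho)=-\operatorname{Tr}\{\rho\log_2\rho\}$. For a state $\rho_{AB}$ let $H(A|B)_\rho=H(\rho_{AB})-H(\rho_B)$ be the conditional quantum entropy, and let $$H_2(A|B)_\rho=-\log_2\operatorname{Tr}\{\rho_{AB}\,\rho_B^{-1/2}\,\rho_{AB}\,\rho_B^{-1/2}\}$$ be the collision conditional entropy, the inverse being taken on the support of $\rho_B$. Let $x=(x_1,\ldots,x_K)\mapsto\rho_{x}$ be a $K$-sender classical-input quantum-output multiple-access channel with finite input alphabets $\mathcal X_1,\ldots,\mathcal X_K$ and density operators $\rho_x$ on a finite-dimensional output system $C$. Let $p_{X_1},\ldots,p_{X_K}$ be probability distributions on the alphabets and put $$\omega_{X_1\cdots X_KC}=\sum_{x_1,\ldots,x_K}p_{X_1}(x_1)\cdots p_{X_K}(x_K)\,|x_1\rangle\langle x_1|_{X_1}\otimes\cdots\otimes|x_K\rangle\langle x_K|_{X_K}\otimes\rho_{x_1,\ldots,x_K}.$$ *Codes.* An unassisted code of length $n$ with message sets $[M_1],\ldots,[M_K]$ consists of codewords $x_j(m_j)\in\mathcal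 X_j^n$ for $m_j\in[M_j]$, $j\in[K]$, and a POVM $\{\Lambda_m\}$ on $C^n$ indexed by the tuples $m=(m_1,\ldots,m_K)$. Write $x(m)=(x_1(m_1),\ldots,x_K(m_K))$ and let $\rho_{x(m)}$ be the tensor product of the outputs of the $n$ channel uses. The average error probability is $$\frac{1}{M_1\cdots M_K}\sum_m\operatorname{Tr}\{(I-\Lambda_m)\rho_{x(m)}\}.$$ Given operators $0\le Q_{x}\le I$ on $C^n$, one for each tuple of input words $x\in\mathcal X_1^n\times\cdots\times\mathcal X_K^n$, the corresponding *quantum simultaneous decoder* is the square-root measurement $$\Omega_m=\Big(\sum_{m'}Q_{x(m')}\Big)^{-1/2}Q_{x(m)}\Big(\sum_{m'}Q_{x(m')}\Big)^{-1/2}$$ (inverse on the support); a code uses it if $\Lambda_m\ge\Omega_m$ for all $m$, i.e. if its POVM completes $\{\Omega_m\}$. *Achievability.* Rates $R_1,\ldots,R_K$ are achievable with a quantum simultaneous decoder if for all $\varepsilon\in(0,1)$, $\delta>0$ and all sufficiently large $n$ there are operators $0\le Q_x\le I$ as above, not depending on the codebook, such that, with $M_j=\lceil2^{n(R_j-\delta)}\rceil$,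 1. the expected average error probability of $\{\Omega_m\}$ is at most $\varepsilon$ for the random codebook with independent letters, those of sender $j$ being distributed according to $p_{X_j}$; and 2. there is an unassisted code with message sets $[M_1],\ldots,[M_K]$ which uses this simultaneous decoder and has average error probability at most $\varepsilon$. **Theorem.** All rates $R_1,\ldots,R_K\ge0$ with $$\sum_{j\in\mathcal J}R_j\le H_2(C|X(\mathcal J^c))_\omega-H(C|X_1\cdots X_K)_\omega\qquad\text{for every non-empty }\mathcal J\subseteq[K]$$ are achievable with a quantum simultaneous decoder for unassisted classical communication over the channel, where $X(\mathcal J^c)$ denotes the systems $X_j$ with $j\notin\mathcal J$. Moreover, $H_2(A|Y)_\sigma=-\log_2\sum_yp(y)\operatorname{Tr}\{\sigma_y^2\}$ for every state $\sigma_{YA}=\sum_yp(y)|y\rangle\langle y|_Y\otimes\sigma_y$ with $Y$ finite, $p$ a probability distribution and density operators $\sigma_y$ on a finite-dimensional space. -/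

import Mathlib

open scoped Kronecker ComplexOrder

noncomputable section

namespace QMAC

/-! ### States, operators and entropies on finite-dimensional systems

A system with orthonormal basis indexed by a finite type `a` has operators `Matrix a a ℂ`. -/

/-- Density operators: positive semi-definite with unit trace. -/
def IsDensity {a : Type*} [Fintype a] (ρ : Matrix a a ℂ) : Prop :=
  ρ.PosSemidef ∧ ρ.trace = 1

/-- The operator `A ^ (-1/2)` of a positive semi-definite `A`, the inverse being taken on the
support of `A` (note that `(√0)⁻¹ = 0` in Lean). -/
def invSqrt {a : Type*} [Fintype a] [DecidableEq a] (A : Matrix a a ℂ) : Matrix a a ℂ :=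
  cfc (fun t : ℝ => (Real.sqrt t)⁻¹) A

/-- Von Neumann entropy in bits, `-Tr {ρ log₂ ρ}`. -/
def entropy {a : Type*} [Fintype a] [DecidableEq a] (ρ : Matrix a a ℂ) : ℝ :=
  -(cfc (fun t : ℝ => t * Real.logb 2 t) ρ).trace.re

/-- Marginal on `B` of an operator on the bipartite system `BA`: the partial trace over `A`. -/
def marginalFst {b a : Type*} [Fintype a] (ρ : Matrix (b × a) (b × a) ℂ) : Matrix b b ℂ :=
  Matrix.of fun i j => ∑ k, ρ (i, k) (j, k)

/-- Conditional entropy `H(A|B) = H(BA) - H(B)` of a state of the bipartite system `BA`. -/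
def condEntropy {b a : Type*} [Fintype b] [DecidableEq b] [Fintype a] [DecidableEq a]
    (ρ : Matrix (b × a) (b × a) ℂ) : ℝ :=
  entropy ρ - entropy (marginalFst ρ)

/-- Collision conditional entropy
`H₂(A|B) = -log₂ Tr {ρ_{BA} ρ_B^{-1/2} ρ_{BA} ρ_B^{-1/2}}` of a state of the bipartite
system `BA`, where `ρ_B^{-1/2}` stands for `ρ_B^{-1/2} ⊗ I_A`. -/
def collisionCondEntropy {b a : Type*} [Fintype b] [DecidableEq b] [Fintype a] [DecidableEq a]
    (ρ : Matrix (b × a) (b × a) ℂ) : ℝ :=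
  -Real.logb 2
    (ρ * (invSqrt (marginalFst ρ) ⊗ₖ (1 : Matrix a a ℂ)) *
      ρ * (invSqrt (marginalFst ρ) ⊗ₖ (1 : Matrix a a ℂ))).trace.re

/-- The classical-quantum state `∑ y, p(y) |y⟩⟨y| ⊗ σ_y`. -/
def cqState {y a : Type*} [Fintype y] [DecidableEq y]
    (p : y → ℝ) (σ : y → Matrix a a ℂ) : Matrix (y × a) (y × a) ℂ :=
  ∑ x, (p x : ℂ) • (Matrix.single x x (1 : ℂ) ⊗ₖ σ x)

/-! ### The channel and its information quantities -/

section Channel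

variable {K : ℕ} {X : Fin K → Type*} {d : Type*}

/-- The input letters `x_1, …, x_K` put together from those in `J` and those outside `J`. -/
def glue (J : Finset (Fin K)) (z : ∀ j : {j // j ∈ J}, X j) (y : ∀ j : {j // j ∉ J}, X j)
    (j : Fin K) : X j :=
  if h : j ∈ J then z ⟨j, h⟩ else y ⟨j, h⟩

/-- The marginal on `X(Jᶜ) C` of an operator on `X_1 ⋯ X_K C`: partial trace over `X(J)`. -/
def marginalCompl [∀ j, Fintype (X j)] (J : Finset (Fin K))
    (ω : Matrix ((∀ j, X j) × d) ((∀ j, X j) × d) ℂ) :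
    Matrix ((∀ j : {j // j ∉ J}, X j) × d) ((∀ j : {j // j ∉ J}, X j) × d) ℂ :=
  Matrix.of fun u v =>
    ∑ z : (∀ j : {j // j ∈ J}, X j), ω (glue J z u.1, u.2) (glue J z v.1, v.2)

variable [∀ j, Fintype (X j)] [∀ j, DecidableEq (X j)] [Fintype d] [DecidableEq d]

/-- The state `ω_{X_1 ⋯ X_K C} = ∑ p_{X_1}(x_1) ⋯ p_{X_K}(x_K) |x_1 ⋯ x_K⟩⟨x_1 ⋯ x_K| ⊗ ρ_x`
for the channel `W : x ↦ ρ_x`. -/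
def omega (W : (∀ j, X j) → Matrix d d ℂ) (p : ∀ j, X j → ℝ) :
    Matrix ((∀ j, X j) × d) ((∀ j, X j) × d) ℂ :=
  cqState (fun x => ∏ j, p j (x j)) W

/-- `I'(X(J); C X(Jᶜ)) = H₂(C|X(Jᶜ)) - H(C|X_1 ⋯ X_K)`. -/
def infoPrime (ω : Matrix ((∀ j, X j) × d) ((∀ j, X j) × d) ℂ) (J : Finset (Fin K)) : ℝ :=
  collisionCondEntropy (marginalCompl J ω) - condEntropy ω

end Channel

/-! ### Codes -/

section Code

variable {K : ℕ} {X : Fin K → Type*} {d : Type*}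

/-- Message tuples `(m_1, …, m_K)` for message sets of sizes `M_1, …, M_K`. -/
abbrev Msg (M : Fin K → ℕ) : Type := ∀ j, Fin (M j)

/-- Codebooks of length `n`: sender `j` has one codeword in `X_j ^ n` for each own message. -/
abbrev Codebook (X : Fin K → Type*) (M : Fin K → ℕ) (n : ℕ) :=
  ∀ j, Fin (M j) → Fin n → X j

/-- The input words that the senders feed in for the message tuple `m`. -/
def Codebook.word {M : Fin K → ℕ} {n : ℕ} (c : Codebook X M n) (m : Msg M) :
    ∀ j, Fin n → X j :=
  fun j => c j (m j)

/-- Output of `n` independent channel uses: `⨂ i, ρ_{x_1(i), …, x_K(i)}`. -/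
def tensorOutput (W : (∀ j, X j) → Matrix d d ℂ) {n : ℕ} (x : ∀ j, Fin n → X j) :
    Matrix (Fin n → d) (Fin n → d) ℂ :=
  Matrix.of fun s t => ∏ i, W (fun j => x j i) (s i) (t i)

variable [Fintype d] [DecidableEq d]

/-- The average over all message tuples of the error probability
`Tr {(I - Λ_m) ρ_{x_1(m_1), …, x_K(m_K)}}`. -/
def avgError (W : (∀ j, X j) → Matrix d d ℂ) {M : Fin K → ℕ} {n : ℕ}
    (c : Codebook X M n) (Λ : Msg M → Matrix (Fin n → d) (Fin n → d) ℂ) : ℝ :=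
  (∏ j, (M j : ℝ))⁻¹ * ∑ m : Msg M, ((1 - Λ m) * tensorOutput W (c.word m)).trace.re

/-- An unassisted code: codebooks of the `K` senders and one POVM on all the channel outputs,
whose outcomes are the tuples of messages of all senders. -/
structure MACCode (X : Fin K → Type*) (d : Type*) [Fintype d] [DecidableEq d]
    (M : Fin K → ℕ) (n : ℕ) where
  codebook : Codebook X M n
  povm : Msg M → Matrix (Fin n → d) (Fin n → d) ℂ
  povm_posSemidef : ∀ m, (povm m).PosSemidef
  povm_sum : ∑ m, povm m = 1

/-- Test operators `0 ≤ Q_x ≤ I` on the channel outputs, one for each tuple `x` of input words. -/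
def IsTest {n : ℕ} (Q : (∀ j, Fin n → X j) → Matrix (Fin n → d) (Fin n → d) ℂ) : Prop :=
  ∀ x, (Q x).PosSemidef ∧ (1 - Q x).PosSemidef

/-- The position-based simultaneous decoder: the square-root measurement
`(∑_{m'} Q_{x(m')})^{-1/2} Q_{x(m)} (∑_{m'} Q_{x(m')})^{-1/2}`. -/
def simulDecoder {M : Fin K → ℕ} {n : ℕ}
    (Q : (∀ j, Fin n → X j) → Matrix (Fin n → d) (Fin n → d) ℂ)
    (c : Codebook X M n) (m : Msg M) : Matrix (Fin n → d) (Fin n → d) ℂ :=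
  invSqrt (∑ m', Q (c.word m')) * Q (c.word m) * invSqrt (∑ m', Q (c.word m'))

/-- The code decodes with the simultaneous decoder built from `Q`. The operators of the
square-root measurement add up to the projection onto the support of `∑_{m'} Q_{x(m')}` only, so
the POVM of the code is a completion of it. -/
def MACCode.UsesSimulDecoder {M : Fin K → ℕ} {n : ℕ} (C : MACCode X d M n)
    (Q : (∀ j, Fin n → X j) → Matrix (Fin n → d) (Fin n → d) ℂ) : Prop :=
  ∀ m, (C.povm m - simulDecoder Q C.codebook m).PosSemidef

/-- The expected average error probability of the simultaneous decoder built from `Q`, for a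
random codebook all of whose letters are independent, those of sender `j` with law `p_{X_j}`. -/
def expectedError [∀ j, Fintype (X j)] (W : (∀ j, X j) → Matrix d d ℂ) (p : ∀ j, X j → ℝ)
    (M : Fin K → ℕ) {n : ℕ}
    (Q : (∀ j, Fin n → X j) → Matrix (Fin n → d) (Fin n → d) ℂ) : ℝ :=
  ∑ c : Codebook X M n,
    (∏ j, ∏ l, ∏ i, p j (c j l i)) * avgError W c (simulDecoder Q c)

/-- Message set sizes `2 ^ (n (R_j - δ))`, rounded up. -/
def numMessages (R : Fin K → ℝ) (δ : ℝ) (n : ℕ) (j : Fin K) : ℕ :=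
  ⌈(2 : ℝ) ^ ((n : ℝ) * (R j - δ))⌉₊

/-- The rates `R_1, …, R_K` are achievable, for unassisted classical communication over the
channel `W` with a quantum simultaneous decoder and input distributions `p_{X_1}, …, p_{X_K}`:
for all `ε ∈ (0,1)`, `δ > 0` and sufficiently large `n`, there are test operators `Q`, not
depending on the codebook, whose simultaneous decoder has expected error at most `ε` on the
random codebook, and there is a (deterministic) code with `2 ^ (n (R_j - δ))` messages for
sender `j` which uses this decoder and has average error probability at most `ε`. -/
def SimulAchievable [∀ j, Fintype (X j)] (W : (∀ j, X j) → Matrix d d ℂ) (p : ∀ j, X j → ℝ)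
    (R : Fin K → ℝ) : Prop :=
  ∀ ε : ℝ, 0 < ε → ε < 1 → ∀ δ : ℝ, 0 < δ → ∃ N : ℕ, ∀ n : ℕ, N ≤ n →
    ∃ Q : (∀ j, Fin n → X j) → Matrix (Fin n → d) (Fin n → d) ℂ,
      IsTest Q ∧
      expectedError W p (numMessages R δ n) Q ≤ ε ∧
      ∃ C : MACCode X d (numMessages R δ n) n,
        C.UsesSimulDecoder Q ∧ avgError W C.codebook C.povm ≤ ε

end Code

end QMAC

end

noncomputable section

namespace QMAC

/-! ### Unitarily diagonalized operators -/

section Diagonal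

variable {a : Type*} [Fintype a] [DecidableEq a]

/-! Write H = H(C|X_1⋯X_K) and let Q_x be the spectral projection of the n-fold output ρ_x onto
eigenvalues at least τ^n, with τ = 2^{-(H+δ/2)}. The one test has to do two things, and the
Hayashi-Nagaoka inequality (`hayashiNagaoka`) bounds the decoding error by a combination of both.

Missed detection: the eigenvalues of ρ_x are products of single-letter ones whose mean logarithm is
-H, so a Chernoff bound (`exists_tail_le_pow`) makes the discarded weight exponentially small.

False alarms: Q_x ≤ τ^{-n} ρ_x, so only the overlap of two outputs matters. If the two message
tuples differ exactly on J, letters outside J are shared and those inside J are independent; the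
mean overlap factorizes over the letters into 2^{-n H_2(C|X(Jᶜ))} (`sum_pairLaw_trace_eq_rpow`). No
joint typicality of noncommuting marginals is needed, and the same test serves every J. The rate
conditions turn the bound into 2^{nδ/2} ∏_{j∈J} 2^{-nR_j}, and the sum over all wrong tuples
factorizes over the senders (`sum_erase_prod_ite`), leaving (2^K-1) 2^{-nδ/2}.

The formula for H_2 of a classical-quantum state is a blockwise computation
(`collisionCondEntropy_cqState`). -/

/-- The operator `U diag(v) U*` with real eigenvalues `v`. -/
def conjDiagonal (U : unitary (Matrix a a ℂ)) : (a → ℝ) →ₐ[ℝ] Matrix a a ℂ where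
  toFun v := (U : Matrix a a ℂ) * Matrix.diagonal (fun i => (v i : ℂ)) * star (U : Matrix a a ℂ)
  map_one' := by simp
  map_zero' := by simp
  map_mul' v w := by
    have h : (Matrix.diagonal fun i => ((v * w) i : ℂ)) =
        Matrix.diagonal (fun i => (v i : ℂ)) * (star (U : Matrix a a ℂ) * (U : Matrix a a ℂ)) *
          Matrix.diagonal (fun i => (w i : ℂ)) := by
      simp
    rw [h]
    simp only [mul_assoc]
  map_add' v w := by
    rw [← add_mul, ← mul_add, Matrix.diagonal_add]
    simp
  commutes' r := by
    have h : (Matrix.diagonal fun i => ((algebraMap ℝ (a → ℝ) r) i : ℂ)) =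
        algebraMap ℝ (Matrix a a ℂ) r := by
      ext i j
      simp [Matrix.algebraMap_matrix_apply, Matrix.diagonal_apply]
    rw [h, ← Algebra.commutes, mul_assoc, Unitary.mul_star_self_of_mem U.2, mul_one]

theorem conjDiagonal_def (U : unitary (Matrix a a ℂ)) (v : a → ℝ) :
    conjDiagonal U v = (U : Matrix a a ℂ) * Matrix.diagonal (fun i => (v i : ℂ)) *
      star (U : Matrix a a ℂ) := rfl

theorem isHermitian_conjDiagonal (U : unitary (Matrix a a ℂ)) (v : a → ℝ) :
    (conjDiagonal U v).IsHermitian := by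
  rw [conjDiagonal_def, Matrix.IsHermitian, Matrix.star_eq_conjTranspose]
  simp only [Matrix.conjTranspose_mul, Matrix.conjTranspose_conjTranspose,
    Matrix.diagonal_conjTranspose, mul_assoc]
  congr 3
  ext i
  simp

theorem posSemidef_conjDiagonal (U : unitary (Matrix a a ℂ)) {v : a → ℝ} (hv : ∀ i, 0 ≤ v i) :
    (conjDiagonal U v).PosSemidef := by
  refine Matrix.PosSemidef.mul_mul_conjTranspose_same ?_ (U : Matrix a a ℂ)
  rw [Matrix.posSemidef_diagonal_iff]
  exact fun i => by exact_mod_cast hv i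

theorem trace_conjDiagonal (U : unitary (Matrix a a ℂ)) (v : a → ℝ) :
    (conjDiagonal U v).trace = ((∑ i, v i : ℝ) : ℂ) := by
  rw [conjDiagonal_def, Matrix.trace_mul_comm, ← mul_assoc, Unitary.star_mul_self_of_mem U.2,
    one_mul, Matrix.trace_diagonal]
  push_cast
  rfl

theorem conjDiagonal_one (v : a → ℝ) :
    conjDiagonal 1 v = Matrix.diagonal (fun i => (v i : ℂ)) := by
  simp [conjDiagonal_def]

theorem spectrum_conjDiagonal_subset (U : unitary (Matrix a a ℂ)) (v : a → ℝ) :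
    spectrum ℝ (conjDiagonal U v) ⊆ Set.range v := by
  refine (AlgHom.spectrum_apply_subset (conjDiagonal U) v).trans ?_
  intro r hr
  rw [Pi.spectrum_eq] at hr
  obtain ⟨i, hi⟩ := Set.mem_iUnion.1 hr
  refine ⟨i, ?_⟩
  simpa [spectrum.mem_iff, sub_eq_zero, eq_comm] using hi

/-- The functional calculus acts on the eigenvalues. -/
theorem cfc_conjDiagonal (f : ℝ → ℝ) (U : unitary (Matrix a a ℂ)) (v : a → ℝ) :
    cfc f (conjDiagonal U v) = conjDiagonal U (fun i => f (v i)) := by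
  -- The spectrum is finite, so any `f`, continuous or not, agrees on it with an interpolating
  -- polynomial, and polynomials commute with the algebra homomorphism `conjDiagonal U`.
  set q : Polynomial ℝ := Lagrange.interpolate (Finset.univ.image v) id f with hq
  have hqf : ∀ i, q.eval (v i) = f (v i) := fun i =>
    Lagrange.eval_interpolate_at_node (s := Finset.univ.image v) (v := id) f
      Function.injective_id.injOn (i := v i) (by simp)
  have h1 : cfc f (conjDiagonal U v) = cfc (fun t => q.eval t) (conjDiagonal U v) := by
    refine cfc_congr fun t ht => ?_
    obtain ⟨i, rfl⟩ := spectrum_conjDiagonal_subset U v ht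
    exact (hqf i).symm
  rw [h1, cfc_polynomial q (conjDiagonal U v) (isHermitian_conjDiagonal U v).isSelfAdjoint,
    Polynomial.aeval_algHom_apply]
  congr 1
  ext i
  rw [← hqf i, ← Polynomial.coe_aeval_eq_eval]
  exact (Polynomial.aeval_algHom_apply (Pi.evalAlgHom ℝ (fun _ : a => ℝ) i) v q).symm

theorem exists_eq_conjDiagonal {A : Matrix a a ℂ} (hA : A.IsHermitian) :
    ∃ (U : unitary (Matrix a a ℂ)) (v : a → ℝ), A = conjDiagonal U v :=
  ⟨hA.eigenvectorUnitary, hA.eigenvalues, hA.spectral_theorem⟩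

theorem nonneg_of_posSemidef_conjDiagonal {U : unitary (Matrix a a ℂ)} {v : a → ℝ}
    (h : (conjDiagonal U v).PosSemidef) (i : a) : 0 ≤ v i := by
  have h1 := h.mul_mul_conjTranspose_same (star (U : Matrix a a ℂ))
  have h2 : star (U : Matrix a a ℂ) * conjDiagonal U v * (star (U : Matrix a a ℂ)).conjTranspose =
      Matrix.diagonal (fun i => (v i : ℂ)) := by
    rw [conjDiagonal_def, Matrix.star_eq_conjTranspose, Matrix.conjTranspose_conjTranspose,
      ← Matrix.star_eq_conjTranspose]
    calc _ = (star (U : Matrix a a ℂ) * (U : Matrix a a ℂ)) * Matrix.diagonal (fun i => (v i : ℂ))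
          * (star (U : Matrix a a ℂ) * (U : Matrix a a ℂ)) := by simp only [mul_assoc]
      _ = _ := by simp
  rw [h2, Matrix.posSemidef_diagonal_iff] at h1
  exact_mod_cast h1 i

/-- Spectral decomposition of a density operator. -/
theorem IsDensity.exists_eq_conjDiagonal {ρ : Matrix a a ℂ} (hρ : IsDensity ρ) :
    ∃ (U : unitary (Matrix a a ℂ)) (v : a → ℝ),
      ρ = conjDiagonal U v ∧ (∀ i, 0 ≤ v i) ∧ ∑ i, v i = 1 := by
  obtain ⟨U, v, rfl⟩ := QMAC.exists_eq_conjDiagonal hρ.1.1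
  refine ⟨U, v, rfl, nonneg_of_posSemidef_conjDiagonal hρ.1, ?_⟩
  have := hρ.2
  rw [trace_conjDiagonal] at this
  exact_mod_cast this

theorem trace_mul_re_nonneg {A B : Matrix a a ℂ} (hA : A.PosSemidef) (hB : B.PosSemidef) :
    0 ≤ (A * B).trace.re := by
  obtain ⟨C, rfl⟩ : ∃ C : Matrix a a ℂ, B = C * C.conjTranspose := by
    obtain ⟨U, v, rfl⟩ := QMAC.exists_eq_conjDiagonal hB.1
    have hv := nonneg_of_posSemidef_conjDiagonal hB
    refine ⟨conjDiagonal U (fun i => √(v i)), ?_⟩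
    rw [(isHermitian_conjDiagonal U _).eq, ← map_mul]
    congr 1
    ext i
    exact (Real.mul_self_sqrt (hv i)).symm
  rw [← mul_assoc, Matrix.trace_mul_comm, ← mul_assoc]
  exact (Complex.le_def.1 (hA.conjTranspose_mul_mul_same C).trace_nonneg).1

theorem trace_mul_re_mono {A B C : Matrix a a ℂ} (hAB : (B - A).PosSemidef)
    (hC : C.PosSemidef) : (A * C).trace.re ≤ (B * C).trace.re := by
  have := trace_mul_re_nonneg hAB hC
  rw [sub_mul, Matrix.trace_sub, Complex.sub_re] at this
  linarith

end Diagonal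

/-! ### The Hayashi-Nagaoka inequality -/

section HayashiNagaoka

variable {a : Type*} [Fintype a] [DecidableEq a]

open scoped MatrixOrder Matrix.Norms.L2Operator in
/-- A test operator is dominated by the square root of every larger operator. -/
theorem posSemidef_cfc_sqrt_sub {S T : Matrix a a ℂ} (hS : S.PosSemidef)
    (hS1 : (1 - S).PosSemidef) (hT : T.PosSemidef) :
    (cfc Real.sqrt (S + T) - S).PosSemidef := by
  -- The eigenvalues of `S` lie in [0,1], where t ≤ √t; operator monotonicity of the square root
  -- does the rest.
  have h1 : S ≤ CFC.sqrt S := by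
    obtain ⟨U, v, rfl⟩ := exists_eq_conjDiagonal hS.1
    have hv := nonneg_of_posSemidef_conjDiagonal hS
    have hv1 : ∀ i, 0 ≤ (1 - v) i := by
      rw [← map_one (conjDiagonal U), ← map_sub] at hS1
      exact nonneg_of_posSemidef_conjDiagonal hS1
    rw [CFC.sqrt_eq_real_sqrt _ hS.nonneg, cfcₙ_eq_cfc (hf0 := Real.sqrt_zero),
      cfc_conjDiagonal, Matrix.le_iff, ← map_sub]
    refine posSemidef_conjDiagonal U fun i => ?_
    have := hv1 i
    simp only [Pi.sub_apply, Pi.one_apply, sub_nonneg] at this ⊢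
    exact Real.le_sqrt_of_sq_le (by nlinarith [hv i])
  have h2 : CFC.sqrt S ≤ CFC.sqrt (S + T) :=
    CFC.sqrt_le_sqrt _ _ (le_add_of_nonneg_right hT.nonneg)
  have h3 := h1.trans h2
  rwa [CFC.sqrt_eq_real_sqrt _ (hS.add hT).nonneg, cfcₙ_eq_cfc (hf0 := Real.sqrt_zero),
    Matrix.le_iff] at h3

/-- The Hayashi-Nagaoka inequality, with the inverse square root taken on the support. -/
theorem hayashiNagaoka {S T : Matrix a a ℂ} (hS : S.PosSemidef)
    (hS1 : (1 - S).PosSemidef) (hT : T.PosSemidef) :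
    (2 • (1 - S) + 4 • T -
      (1 - invSqrt (S + T) * S * invSqrt (S + T))).PosSemidef := by
  have hsq := posSemidef_cfc_sqrt_sub hS hS1 hT
  obtain ⟨U, v, hv⟩ := exists_eq_conjDiagonal (hS.add hT).1
  have hv0 : ∀ i, 0 ≤ v i := by
    refine nonneg_of_posSemidef_conjDiagonal (U := U) ?_
    rw [← hv]
    exact hS.add hT
  rw [hv, cfc_conjDiagonal] at hsq
  rw [invSqrt, hv, cfc_conjDiagonal]
  set R := conjDiagonal U (fun i => (√(v i))⁻¹) with hR
  set D := conjDiagonal U (fun i => √(v i)) with hD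
  have hRH : R.conjTranspose = R := (isHermitian_conjDiagonal U _).eq
  -- the three positive remainders
  have hp1 : ((R - 1) * S * (R - 1)).PosSemidef := by
    have := hS.mul_mul_conjTranspose_same (R - 1)
    rwa [Matrix.conjTranspose_sub, hRH, Matrix.conjTranspose_one] at this
  have hp2 : ((R - 2) * T * (R - 2)).PosSemidef := by
    have := hT.mul_mul_conjTranspose_same (R - 2)
    rwa [Matrix.conjTranspose_sub, hRH, Matrix.conjTranspose_ofNat] at this
  have hp3 : (1 - R * conjDiagonal U v * R).PosSemidef := by
    rw [hR, ← map_one (conjDiagonal U), ← map_mul, ← map_mul, ← map_sub]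
    refine posSemidef_conjDiagonal U fun i => ?_
    simp only [Pi.sub_apply, Pi.one_apply, Pi.mul_apply, sub_nonneg]
    -- Since (√0)⁻¹ = 0, the kernel contributes 0: `R * conjDiagonal U v * R` is the support
    -- projection, not the identity.
    rcases (hv0 i).eq_or_lt with h | h
    · simp [← h]
    · have h' := Real.sqrt_pos.2 h
      rw [mul_comm, ← mul_assoc, ← mul_inv, Real.mul_self_sqrt h.le, inv_mul_cancel₀ h.ne']
  have hRV : R * conjDiagonal U v = D := by
    rw [hR, hD, ← map_mul]
    congr 1
    ext i
    simp only [Pi.mul_apply]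
    rw [inv_mul_eq_div, Real.div_sqrt]
  have hVR : conjDiagonal U v * R = D := by
    rw [← hRV, hR, ← map_mul, ← map_mul, mul_comm]
  have hRT : R * T = D - R * S := by
    rw [← hRV, ← hv]
    noncomm_ring
  have hTR : T * R = D - S * R := by
    rw [← hVR, ← hv]
    noncomm_ring
  have e2 : (R - 2) * T * (R - 2) = (D - R * S) * R - 2 • (D - R * S) - 2 • (D - S * R) + 4 • T := by
    rw [← hRT, ← hTR]
    noncomm_ring
  -- With R = (S+T)^{-1/2} and D = (S+T)^{1/2}, the operator to be bounded below equals this sum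
  -- exactly: R(S+T) = (S+T)R = D cancels the cross terms against 4D.
  have h4 : (4 • (D - S) + 2 • ((R - 1) * S * (R - 1)) + (R - 2) * T * (R - 2) +
      (1 - R * conjDiagonal U v * R)).PosSemidef :=
    (((hsq.smul zero_le).add (hp1.smul zero_le)).add hp2).add hp3
  convert h4 using 1
  rw [e2, hRV]
  noncomm_ring

end HayashiNagaoka

/-! ### Classical-quantum states -/

section CQ

variable {y a : Type*} [Fintype y] [DecidableEq y]

theorem cqState_apply (p : y → ℝ) (σ : y → Matrix a a ℂ) (u v : y × a) :
    cqState p σ u v = if u.1 = v.1 then (p u.1 : ℂ) * σ u.1 u.2 v.2 else 0 := by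
  simp only [cqState, Matrix.sum_apply, Matrix.smul_apply, Matrix.kroneckerMap_apply,
    Matrix.single_apply, smul_eq_mul, ite_mul, one_mul, zero_mul, mul_ite, mul_zero]
  by_cases h : u.1 = v.1
  · simp [h]
  · rw [if_neg h]
    refine Finset.sum_eq_zero fun x _ => if_neg ?_
    rintro ⟨h1, h2⟩
    exact h (h1.symm.trans h2)

/-- Puts ρ_B^{-1/2} ⊗ I into classical-quantum form, so that products can be taken block by block.
-/
theorem diagonal_kronecker_one [DecidableEq a] (p : y → ℝ) :
    Matrix.diagonal (fun x => (p x : ℂ)) ⊗ₖ (1 : Matrix a a ℂ) = cqState p (fun _ => 1) := by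
  ext u v
  by_cases h : u.1 = v.1 <;> simp [cqState_apply, h]

variable [Fintype a]

theorem cqState_mul_cqState (p q : y → ℝ) (σ τ : y → Matrix a a ℂ) :
    cqState p σ * cqState q τ = cqState (p * q) (fun x => σ x * τ x) := by
  ext u v
  simp only [Matrix.mul_apply, cqState_apply, Fintype.sum_prod_type, Pi.mul_apply]
  rw [Finset.sum_eq_single u.1 (fun b _ hb => by simp [hb.symm]) (by simp)]
  by_cases h : u.1 = v.1
  · simp only [h, if_true, Finset.mul_sum]
    exact Finset.sum_congr rfl fun k _ => by push_cast; ring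
  · simp [h]

theorem trace_cqState (p : y → ℝ) (σ : y → Matrix a a ℂ) :
    (cqState p σ).trace = ∑ x, (p x : ℂ) * (σ x).trace := by
  simp [Matrix.trace, cqState_apply, Fintype.sum_prod_type, Finset.mul_sum]

theorem marginalFst_cqState (p : y → ℝ) {σ : y → Matrix a a ℂ} (hσ : ∀ x, (σ x).trace = 1) :
    marginalFst (cqState p σ) = Matrix.diagonal (fun x => (p x : ℂ)) := by
  ext u v
  by_cases h : u = v
  · subst h
    have := hσ u
    simp only [Matrix.trace, Matrix.diag_apply] at this
    simp [marginalFst, cqState_apply, ← Finset.mul_sum, this]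
  · simp [marginalFst, cqState_apply, h]

variable [DecidableEq a]

/-- The collision conditional entropy of a classical-quantum state. -/
theorem collisionCondEntropy_cqState {p : y → ℝ} (hp : ∀ x, 0 ≤ p x) {σ : y → Matrix a a ℂ}
    (hσ : ∀ x, (σ x).trace = 1) :
    collisionCondEntropy (cqState p σ) =
      -Real.logb 2 (∑ x, p x * (σ x * σ x).trace.re) := by
  rw [collisionCondEntropy, marginalFst_cqState p hσ, ← conjDiagonal_one, invSqrt,
    cfc_conjDiagonal, conjDiagonal_one, diagonal_kronecker_one (fun x => (√(p x))⁻¹)]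
  simp only [cqState_mul_cqState, trace_cqState, mul_one, Complex.re_sum, Complex.re_ofReal_mul,
    Pi.mul_apply]
  congr 2
  refine Finset.sum_congr rfl fun x _ => ?_
  congr 1
  -- The block weight is p · p^{-1/2} · p · p^{-1/2} = p; at p = 0 both sides vanish by the support
  -- convention.
  rcases (hp x).eq_or_lt with h | h
  · simp [← h]
  · have h' := Real.sqrt_pos.2 h
    field_simp
    rw [Real.sq_sqrt h.le]

/-- The block diagonal unitary with blocks `U x`. -/
def blockUnitary (U : y → unitary (Matrix a a ℂ)) : unitary (Matrix (y × a) (y × a) ℂ) :=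
  ⟨cqState 1 (fun x => (U x : Matrix a a ℂ)), by
    have h1 : star (cqState 1 (fun x => (U x : Matrix a a ℂ))) =
        cqState 1 (fun x => star (U x : Matrix a a ℂ)) := by
      ext u v
      rw [Matrix.star_apply]
      by_cases h : u.1 = v.1
      · simp [cqState_apply, h]
      · simp [cqState_apply, h, Ne.symm h]
    have h2 : cqState 1 (fun _ => 1) = (1 : Matrix (y × a) (y × a) ℂ) := by
      rw [← diagonal_kronecker_one]
      simp
    rw [Unitary.mem_iff, h1, cqState_mul_cqState, cqState_mul_cqState]
    simp [h2]⟩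

/-- Diagonalizing each block diagonalizes the whole state, so its entropy becomes a sum over the
products of probabilities and block eigenvalues. -/
theorem conjDiagonal_blockUnitary (U : y → unitary (Matrix a a ℂ)) (p : y → ℝ) (v : y → a → ℝ) :
    conjDiagonal (blockUnitary U) (fun u => p u.1 * v u.1 u.2) =
      cqState p (fun x => conjDiagonal (U x) (v x)) := by
  have h1 : star (cqState 1 (fun x => (U x : Matrix a a ℂ))) =
      cqState 1 (fun x => star (U x : Matrix a a ℂ)) := by
    ext u v
    rw [Matrix.star_apply]
    by_cases h : u.1 = v.1
    · simp [cqState_apply, h]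
    · simp [cqState_apply, h, Ne.symm h]
  have h2 : Matrix.diagonal (fun u : y × a => ((p u.1 * v u.1 u.2 : ℝ) : ℂ)) =
      cqState p (fun x => Matrix.diagonal (fun i => (v x i : ℂ))) := by
    ext u w
    by_cases h : u.1 = w.1 <;> by_cases h' : u.2 = w.2 <;>
      simp [cqState_apply, h, h', Matrix.diagonal_apply, Prod.ext_iff]
  rw [conjDiagonal_def, h2, blockUnitary, h1, cqState_mul_cqState, cqState_mul_cqState]
  simp [conjDiagonal_def]

theorem entropy_conjDiagonal (U : unitary (Matrix a a ℂ)) (v : a → ℝ) :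
    entropy (conjDiagonal U v) = -∑ i, v i * Real.logb 2 (v i) := by
  rw [entropy, cfc_conjDiagonal, trace_conjDiagonal, Complex.ofReal_re]

/-- The conditional entropy of a classical-quantum state is the average entropy. -/
theorem condEntropy_cqState (p : y → ℝ) (U : y → unitary (Matrix a a ℂ)) {v : y → a → ℝ}
    (hv : ∀ x, ∑ i, v x i = 1) :
    condEntropy (cqState p (fun x => conjDiagonal (U x) (v x))) =
      -∑ x, ∑ i, p x * v x i * Real.logb 2 (v x i) := by
  rw [condEntropy, marginalFst_cqState p (fun x => by rw [trace_conjDiagonal, hv]; simp),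
    ← conjDiagonal_blockUnitary, ← conjDiagonal_one, entropy_conjDiagonal, entropy_conjDiagonal,
    Fintype.sum_prod_type]
  rw [neg_sub_neg, eq_neg_iff_add_eq_zero, sub_add_eq_add_sub, sub_eq_zero,
    ← Finset.sum_add_distrib]
  refine Finset.sum_congr rfl fun x _ => ?_
  -- Chain rule: the eigenvalues of a block sum to one, so p log p can be spread over them and
  -- cancels the log p part of log(pv).
  have h1 : p x * Real.logb 2 (p x) = ∑ i, p x * v x i * Real.logb 2 (p x) := by
    rw [← Finset.sum_mul, ← Finset.mul_sum, hv, mul_one]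
  rw [h1, ← Finset.sum_add_distrib]
  refine Finset.sum_congr rfl fun i _ => ?_
  by_cases hp : p x = 0
  · simp [hp]
  by_cases hw : v x i = 0
  · simp [hw]
  rw [Real.logb_mul hp hw]
  ring

end CQ

/-! ### Tensor products -/

section Tensor

variable {d : Type*} {n : ℕ}

/-- The tensor product of operators. -/
def piTensor (A : Fin n → Matrix d d ℂ) : Matrix (Fin n → d) (Fin n → d) ℂ :=
  Matrix.of fun s t => ∏ i, A i (s i) (t i)

theorem piTensor_one [DecidableEq d] : piTensor (fun _ => 1) = (1 : Matrix (Fin n → d) (Fin n → d) ℂ) := by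
  ext s t
  by_cases h : s = t
  · subst h
    simp [piTensor]
  · obtain ⟨i, hi⟩ := Function.ne_iff.1 h
    rw [Matrix.one_apply_ne h]
    exact Finset.prod_eq_zero (Finset.mem_univ i) (Matrix.one_apply_ne hi)

theorem star_piTensor (A : Fin n → Matrix d d ℂ) :
    star (piTensor A) = piTensor (fun i => star (A i)) := by
  ext s t
  simp [piTensor, Matrix.star_apply]

variable [Fintype d]

theorem piTensor_mul (A B : Fin n → Matrix d d ℂ) :
    piTensor A * piTensor B = piTensor (fun i => A i * B i) := by
  ext s t
  simp only [piTensor, Matrix.mul_apply, Matrix.of_apply, ← Finset.prod_mul_distrib]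
  rw [Fintype.prod_sum]

theorem trace_piTensor (A : Fin n → Matrix d d ℂ) :
    (piTensor A).trace = ∏ i, (A i).trace := by
  simp only [piTensor, Matrix.trace, Matrix.diag_apply, Matrix.of_apply]
  rw [Fintype.prod_sum]

variable [DecidableEq d]

/-- The tensor product of unitaries. -/
def tensorUnitary (U : Fin n → unitary (Matrix d d ℂ)) :
    unitary (Matrix (Fin n → d) (Fin n → d) ℂ) :=
  ⟨piTensor (fun i => (U i : Matrix d d ℂ)), by
    rw [Unitary.mem_iff, star_piTensor, piTensor_mul, piTensor_mul]
    simp [piTensor_one]⟩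

/-- Eigenvalues of a tensor product are products of letter eigenvalues; this reduces the spectral
test to a classical statement on independent factors. -/
theorem conjDiagonal_tensorUnitary (U : Fin n → unitary (Matrix d d ℂ)) (v : Fin n → d → ℝ) :
    conjDiagonal (tensorUnitary U) (fun k => ∏ i, v i (k i)) =
      piTensor (fun i => conjDiagonal (U i) (v i)) := by
  have h : Matrix.diagonal (fun k : Fin n → d => ((∏ i, v i (k i) : ℝ) : ℂ)) =
      piTensor (fun i => Matrix.diagonal (fun j => (v i j : ℂ))) := by
    ext s t
    by_cases h : s = t
    · simp [piTensor, h]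
    · obtain ⟨i, hi⟩ := Function.ne_iff.1 h
      rw [Matrix.diagonal_apply_ne _ h]
      exact (Finset.prod_eq_zero (Finset.mem_univ i) (Matrix.diagonal_apply_ne (fun j => (v i j : ℂ)) hi)).symm
  rw [conjDiagonal_def, h, tensorUnitary, star_piTensor, piTensor_mul, piTensor_mul]
  rfl

end Tensor

/-! ### A tail bound for products of independent factors -/

section Tail

open Filter Topology in
/-- Chernoff bound: if `log w` has positive mean, then the product of `n` independent copies of `w`
is at least one except with exponentially small probability. -/
theorem exists_tail_le_pow {A : Type*} [Fintype A] {P w : A → ℝ} (hP : ∀ a, 0 ≤ P a)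
    (hsum : ∑ a, P a = 1) (hw : ∀ a, P a ≠ 0 → 0 < w a) (hmean : 0 < ∑ a, P a * Real.log (w a)) :
    ∃ r : ℝ, 0 ≤ r ∧ r < 1 ∧ ∀ n : ℕ,
      ∑ b : Fin n → A, (∏ i, P (b i)) * (if 1 ≤ ∏ i, w (b i) then 0 else 1) ≤ r ^ n := by
  -- Moment generating function of -log w: it is 1 at 0 with negative slope there, hence below 1 at
  -- some s > 0.
  set g : ℝ → ℝ := fun s => ∑ a, P a * Real.exp (s * -Real.log (w a)) with hg
  have hg0 : g 0 = 1 := by simp [hg, hsum]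
  have hd : HasDerivAt g (∑ a, P a * -Real.log (w a)) 0 := by
    refine HasDerivAt.fun_sum fun a _ => ?_
    have := (((hasDerivAt_id (0 : ℝ)).mul_const (-Real.log (w a))).exp).const_mul (P a)
    simpa using this
  have hneg : ∑ a, P a * -Real.log (w a) < 0 := by
    simpa [Finset.sum_neg_distrib] using hmean
  obtain ⟨s, hs, hgs⟩ : ∃ s : ℝ, 0 < s ∧ g s < 1 := by
    have h1 := (hasDerivAt_iff_tendsto_slope.1 hd).eventually (gt_mem_nhds hneg)
    have h2 : ∀ᶠ s in 𝓝[>] (0 : ℝ), slope g 0 s < 0 :=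
      h1.filter_mono (nhdsWithin_mono _ fun x hx => ne_of_gt hx)
    obtain ⟨s, hs, hs0⟩ := (h2.and self_mem_nhdsWithin).exists
    have hs0 : 0 < s := hs0
    refine ⟨s, hs0, ?_⟩
    rw [slope_def_field, hg0, sub_zero, div_lt_iff₀ hs0] at hs
    linarith
  refine ⟨g s, Finset.sum_nonneg fun a _ => mul_nonneg (hP a) (Real.exp_pos _).le, hgs,
    fun n => ?_⟩
  rw [hg, Fintype.sum_pow]
  refine Finset.sum_le_sum fun b _ => ?_
  rw [Finset.prod_mul_distrib]
  -- Words of probability zero are set aside because `w` need not be positive on their letters.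
  by_cases h0 : ∏ i, P (b i) = 0
  · simp [h0]
  have hpos : ∀ i, 0 < w (b i) := fun i => hw _ (Finset.prod_ne_zero_iff.1 h0 i (Finset.mem_univ i))
  refine mul_le_mul_of_nonneg_left ?_ (Finset.prod_nonneg fun i _ => hP _)
  split_ifs with h
  · exact Finset.prod_nonneg fun i _ => (Real.exp_pos _).le
  -- Markov step: where ∏ w < 1, the indicator 1 is at most (∏ w)^{-s}.
  · rw [← Real.exp_sum, ← Finset.mul_sum, Finset.sum_neg_distrib,
      ← Real.log_prod (fun i _ => (hpos i).ne')]
    refine Real.one_le_exp (mul_nonneg hs.le (neg_nonneg.2 (Real.log_nonpos ?_ (not_le.1 h).le)))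
    exact Finset.prod_nonneg fun i _ => (hpos i).le

end Tail

/-! ### Expectations over random codebooks -/

section RandomCodebook

/-- The joint law of two codeword letters of law `P`: equal letters, if the messages agree, and
independent letters otherwise. -/
def pairLaw {Z : Type*} [DecidableEq Z] (same : Prop) [Decidable same] (P : Z → ℝ) (a b : Z) : ℝ :=
  if same then (if a = b then P a else 0) else P a * P b

/-- The two indicators can be written as factors attached to the positions m and m', so the sum
factorizes and every other position contributes ∑ P = 1. -/
theorem sum_codewords {Z ι : Type*} [Fintype Z] [DecidableEq Z] [Fintype ι] [DecidableEq ι]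
    {P : Z → ℝ} (hP : ∑ z, P z = 1) (m m' : ι) (a b : Z) :
    ∑ c : ι → Z, (∏ l, P (c l)) * ((if c m = a then 1 else 0) * (if c m' = b then 1 else 0)) =
      pairLaw (m = m') P a b := by
  have h1 : ∀ c : ι → Z,
      (∏ l, P (c l)) * ((if c m = a then 1 else 0) * (if c m' = b then 1 else 0)) =
      ∏ l, P (c l) * ((if l = m then (if c l = a then 1 else 0) else 1) *
        (if l = m' then (if c l = b then 1 else 0) else 1)) := by
    intro c
    simp only [Finset.prod_mul_distrib, Finset.prod_ite_eq', Finset.mem_univ, if_true]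
  simp only [h1]
  rw [← Fintype.prod_sum (fun l z => P z * ((if l = m then (if z = a then 1 else 0) else 1) *
        (if l = m' then (if z = b then 1 else 0) else 1)))]
  by_cases h : m = m'
  · subst h
    rw [Fintype.prod_eq_single m (fun l hl => by simp [hl, hP])]
    by_cases hab : a = b
    · subst hab
      simp [pairLaw]
    · simp only [pairLaw, if_true, hab, if_false]
      refine Finset.sum_eq_zero fun z _ => ?_
      by_cases hz : z = a
      · simp [hz, hab]
      · simp [hz]
  · rw [Fintype.prod_eq_mul m m' h (fun l hl => by simp [hl.1, hl.2, hP])]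
    simp [pairLaw, h, Ne.symm h]

variable {K : ℕ} {Z : Fin K → Type*} [∀ j, Fintype (Z j)]

theorem sum_piComm {n : ℕ} (F : (∀ j, Fin n → Z j) → ℝ) :
    ∑ a, F a = ∑ a : Fin n → ∀ j, Z j, F (fun j i => a i j) :=
  Fintype.sum_equiv (Equiv.piComm _) _ _ fun _ => rfl

/-- Sums over pairs of tuples of words factorize into sums over pairs of tuples of letters. -/
theorem sum_sum_prod_eq_pow {n : ℕ} (w : ∀ j, Z j → Z j → ℝ) (g : (∀ j, Z j) → (∀ j, Z j) → ℝ) :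
    ∑ a : (∀ j, Fin n → Z j), ∑ b : (∀ j, Fin n → Z j),
        (∏ j, ∏ i, w j (a j i) (b j i)) * ∏ i, g (fun j => a j i) (fun j => b j i) =
      (∑ a, ∑ b, (∏ j, w j (a j) (b j)) * g a b) ^ n := by
  rw [sum_piComm, Fintype.sum_pow]
  refine Finset.sum_congr rfl fun a _ => ?_
  rw [sum_piComm, Fintype.prod_sum]
  refine Finset.sum_congr rfl fun b _ => ?_
  rw [Finset.prod_comm, ← Finset.prod_mul_distrib]

variable [∀ j, DecidableEq (Z j)]

theorem prod_ite_eq_one_zero {ι : Type*} [Fintype ι] [DecidableEq ι] {Y : ι → Type*}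
    [∀ j, DecidableEq (Y j)] (u a : ∀ j, Y j) :
    ∏ j, (if u j = a j then (1 : ℝ) else 0) = if u = a then 1 else 0 := by
  rw [Finset.prod_ite_zero]
  simp [funext_iff]

/-- The expectation of a function of two tuples of codewords of a random codebook. -/
theorem sum_codebooks {M : Fin K → ℕ} {P : ∀ j, Z j → ℝ} (hP : ∀ j, ∑ z, P j z = 1)
    (m m' : ∀ j, Fin (M j)) (G : (∀ j, Z j) → (∀ j, Z j) → ℝ) :
    ∑ c : (∀ j, Fin (M j) → Z j),
        (∏ j, ∏ l, P j (c j l)) * G (fun j => c j (m j)) (fun j => c j (m' j)) =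
      ∑ a, ∑ b, (∏ j, pairLaw (m j = m' j) (P j) (a j) (b j)) * G a b := by
  -- Expanding `G` into point masses separates the senders, whose codebooks are independent.
  have hG : ∀ u v, G u v = ∑ a, ∑ b,
      (∏ j, ((if u j = a j then 1 else 0) * (if v j = b j then 1 else 0))) * G a b := by
    intro u v
    simp only [Finset.prod_mul_distrib, prod_ite_eq_one_zero]
    simp
  simp only [← fun j a b => sum_codewords (hP j) (m j) (m' j) a b]
  have hprod : ∀ a b : (∀ j, Z j), (∏ j, ∑ c : Fin (M j) → Z j, (∏ l, P j (c l)) *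
      ((if c (m j) = a j then 1 else 0) * (if c (m' j) = b j then 1 else 0))) =
      ∑ c : (∀ j, Fin (M j) → Z j), (∏ j, ∏ l, P j (c j l)) *
        ∏ j, ((if c j (m j) = a j then 1 else 0) * (if c j (m' j) = b j then 1 else 0)) := by
    intro a b
    rw [Fintype.prod_sum]
    simp only [Finset.prod_mul_distrib]
  simp only [hprod, Finset.sum_mul]
  rw [Finset.sum_congr rfl fun a _ => Finset.sum_comm, Finset.sum_comm]
  refine Finset.sum_congr rfl fun c _ => ?_
  rw [hG, Finset.mul_sum]
  refine Finset.sum_congr rfl fun a _ => ?_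
  rw [Finset.mul_sum]
  exact Finset.sum_congr rfl fun b _ => (mul_assoc _ _ _).symm

theorem sum_pairLaw_self {P : ∀ j, Z j → ℝ} (G : (∀ j, Z j) → (∀ j, Z j) → ℝ) :
    ∑ a, ∑ b, (∏ j, pairLaw True (P j) (a j) (b j)) * G a b = ∑ a, (∏ j, P j (a j)) * G a a := by
  refine Finset.sum_congr rfl fun a _ => ?_
  simp only [pairLaw, if_true]
  rw [Finset.sum_eq_single a]
  · simp
  · intro b _ hb
    obtain ⟨j, hj⟩ := Function.ne_iff.1 hb
    rw [Finset.prod_eq_zero (Finset.mem_univ j) (if_neg (Ne.symm hj)), zero_mul]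
  · simp

/-- The joint law of two codewords with independent letters is a product law. -/
theorem pairLaw_prod {Y : Type*} [DecidableEq Y] (same : Prop) [Decidable same] (P : Y → ℝ)
    {n : ℕ} (a b : Fin n → Y) :
    pairLaw same (fun z : Fin n → Y => ∏ i, P (z i)) a b = ∏ i, pairLaw same P (a i) (b i) := by
  by_cases h : same
  · simp only [pairLaw, h, if_true]
    by_cases hab : a = b
    · simp [hab]
    · obtain ⟨i, hi⟩ := Function.ne_iff.1 hab
      rw [if_neg hab]
      exact (Finset.prod_eq_zero (Finset.mem_univ i) (if_neg hi)).symm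
  · simp [pairLaw, h, Finset.prod_mul_distrib]

end RandomCodebook

/-! ### Collision probabilities -/

section Collision

variable {K : ℕ} {X : Fin K → Type*} {d : Type*}

theorem prod_glue (J : Finset (Fin K)) (z z' : ∀ j : {j // j ∈ J}, X j)
    (y y' : ∀ j : {j // j ∉ J}, X j) (f : ∀ j, X j → X j → ℝ) :
    ∏ j, f j (glue J z y j) (glue J z' y' j) =
      (∏ j : {j // j ∈ J}, f j (z j) (z' j)) * ∏ j : {j // j ∉ J}, f j (y j) (y' j) := by
  rw [← Fintype.prod_subtype_mul_prod_subtype (fun j => j ∈ J)]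
  congr 1
  · refine Finset.prod_congr (by ext; simp) fun j _ => ?_
    simp [glue, j.2]
  · refine Finset.prod_congr (by ext; simp) fun j _ => ?_
    simp [glue, j.2]

theorem glue_right_inj (J : Finset (Fin K)) (z : ∀ j : {j // j ∈ J}, X j)
    (y y' : ∀ j : {j // j ∉ J}, X j) : glue J z y = glue J z y' ↔ y = y' := by
  refine ⟨fun h => ?_, fun h => h ▸ rfl⟩
  ext j
  have := congrFun h j
  simpa [glue, j.2] using this

variable [∀ j, Fintype (X j)]

theorem sum_eq_sum_glue {β : Type*} [AddCommMonoid β] (J : Finset (Fin K)) (F : (∀ j, X j) → β) :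
    ∑ a, F a = ∑ y, ∑ z, F (glue J z y) := by
  rw [← (Equiv.piEquivPiSubtypeProd (fun j => j ∈ J) X).symm.sum_comp F, Fintype.sum_prod_type,
    Finset.sum_comm]
  rfl

theorem sum_prod_eq_one {ι : Type*} [Fintype ι] [DecidableEq ι] {Y : ι → Type*}
    [∀ j, Fintype (Y j)] {p : ∀ j, Y j → ℝ} (hp : ∀ j, ∑ x, p j x = 1) :
    ∑ x : (∀ j, Y j), ∏ j, p j (x j) = 1 := by
  rw [← Fintype.prod_sum]
  simp [hp]

/-- The output of the channel averaged over the letters of the senders in `J`. -/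
def outputMean (W : (∀ j, X j) → Matrix d d ℂ) (p : ∀ j, X j → ℝ) (J : Finset (Fin K))
    (y : ∀ j : {j // j ∉ J}, X j) : Matrix d d ℂ :=
  ∑ z : (∀ j : {j // j ∈ J}, X j), ((∏ j : {j // j ∈ J}, p j (z j) : ℝ) : ℂ) • W (glue J z y)

theorem isDensity_outputMean [Fintype d] {W : (∀ j, X j) → Matrix d d ℂ}
    (hW : ∀ x, IsDensity (W x))
    {p : ∀ j, X j → ℝ} (hp : ∀ j, p j ∈ stdSimplex ℝ (X j)) (J : Finset (Fin K))
    (y : ∀ j : {j // j ∉ J}, X j) : IsDensity (outputMean W p J y) := by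
  refine ⟨Matrix.posSemidef_sum _ fun z _ => (hW _).1.smul ?_, ?_⟩
  · exact Complex.zero_le_real.2 (Finset.prod_nonneg fun j _ => (hp j).1 _)
  · simp only [outputMean, Matrix.trace_sum, Matrix.trace_smul, (hW _).2, smul_eq_mul, mul_one]
    exact_mod_cast sum_prod_eq_one (p := fun j : {j // j ∈ J} => p j) fun j => (hp j).2

/-- Tracing out X(J) leaves a classical-quantum state labelled by the shared letters, so its
collision entropy involves only Tr σ_y² for the averaged outputs σ_y. -/
theorem marginalCompl_omega [∀ j, DecidableEq (X j)] (W : (∀ j, X j) → Matrix d d ℂ)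
    (p : ∀ j, X j → ℝ) (J : Finset (Fin K)) :
    marginalCompl J (omega W p) = cqState (fun y => ∏ j : {j // j ∉ J}, p j (y j)) (outputMean W p J) := by
  ext u v
  simp only [marginalCompl, omega, Matrix.of_apply, cqState_apply, glue_right_inj]
  split_ifs with h
  · simp only [outputMean, Matrix.sum_apply, Matrix.smul_apply, smul_eq_mul, Finset.mul_sum]
    refine Finset.sum_congr rfl fun z _ => ?_
    rw [prod_glue J z z u.1 u.1 (fun j x _ => p j x)]
    push_cast
    ring
  · simp

variable [∀ j, DecidableEq (X j)] [Fintype d]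

/-- The expected overlap of two outputs, for letters which agree outside `J` and are independent
inside `J`. -/
theorem sum_pairLaw_trace (W : (∀ j, X j) → Matrix d d ℂ) (p : ∀ j, X j → ℝ)
    (J : Finset (Fin K)) (same : Fin K → Prop) [∀ j, Decidable (same j)]
    (hJ : ∀ j, same j ↔ j ∉ J) :
    ∑ a, ∑ b, (∏ j, pairLaw (same j) (p j) (a j) (b j)) * (W b * W a).trace.re =
      ∑ y, (∏ j : {j // j ∉ J}, p j (y j)) * (outputMean W p J y * outputMean W p J y).trace.re := by
  rw [sum_eq_sum_glue J]
  refine Finset.sum_congr rfl fun y _ => ?_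
  have h1 : ∀ z, ∑ b, (∏ j, pairLaw (same j) (p j) (glue J z y j) (b j)) *
      (W b * W (glue J z y)).trace.re =
      ∑ z', ((∏ j : {j // j ∈ J}, p j (z j)) * (∏ j : {j // j ∈ J}, p j (z' j)) * ∏ j : {j // j ∉ J}, p j (y j)) *
        (W (glue J z' y) * W (glue J z y)).trace.re := by
    intro z
    -- The pair law vanishes unless the letters outside `J` coincide.
    rw [sum_eq_sum_glue J, Finset.sum_eq_single y]
    · refine Finset.sum_congr rfl fun z' _ => ?_
      rw [prod_glue J z z' y y (fun j => pairLaw (same j) (p j)), ← Finset.prod_mul_distrib]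
      congr 2
      · exact Finset.prod_congr rfl fun j _ => if_neg fun h => (hJ j).1 h j.2
      · exact Finset.prod_congr rfl fun j _ => by simp [pairLaw, (hJ j).2 j.2]
    · intro y' _ hy
      obtain ⟨j, hj⟩ := Function.ne_iff.1 hy
      refine Finset.sum_eq_zero fun z' _ => ?_
      rw [prod_glue J z z' y y' (fun j => pairLaw (same j) (p j)),
        Finset.prod_eq_zero (Finset.mem_univ j) (by simp [pairLaw, (hJ j).2 j.2, Ne.symm hj]),
        mul_zero, zero_mul]
    · simp
  simp only [h1]
  simp only [outputMean, Finset.sum_mul, Finset.mul_sum, Matrix.trace_sum, Complex.re_sum,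
    Matrix.smul_mul, Matrix.mul_smul, Matrix.trace_smul, smul_eq_mul, Complex.re_ofReal_mul]
  rw [Finset.sum_comm]
  refine Finset.sum_congr rfl fun z _ => Finset.sum_congr rfl fun z' _ => ?_
  rw [Matrix.trace_mul_comm]
  ring

/-- The eigenvalues sum to one, so one is nonzero. Positivity is what allows 2^{log₂ t} = t when the
overlap is rewritten through H_2. -/
theorem trace_sq_re_pos [DecidableEq d] {σ : Matrix d d ℂ} (hσ : IsDensity σ) :
    0 < (σ * σ).trace.re := by
  obtain ⟨U, v, rfl, h0, h1⟩ := hσ.exists_eq_conjDiagonal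
  rw [← map_mul, trace_conjDiagonal, Complex.ofReal_re]
  obtain ⟨i, -, hi⟩ := Finset.exists_ne_zero_of_sum_ne_zero (h1.trans_ne one_ne_zero)
  exact Finset.sum_pos' (fun i _ => mul_self_nonneg _) ⟨i, Finset.mem_univ i, mul_self_pos.2 hi⟩

/-- The expected overlap of two outputs is given by the collision conditional entropy. -/
theorem sum_pairLaw_trace_eq_rpow [DecidableEq d] {W : (∀ j, X j) → Matrix d d ℂ}
    (hW : ∀ x, IsDensity (W x)) {p : ∀ j, X j → ℝ} (hp : ∀ j, p j ∈ stdSimplex ℝ (X j))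
    (J : Finset (Fin K)) (same : Fin K → Prop) [∀ j, Decidable (same j)]
    (hJ : ∀ j, same j ↔ j ∉ J) :
    ∑ a, ∑ b, (∏ j, pairLaw (same j) (p j) (a j) (b j)) * (W b * W a).trace.re =
      (2 : ℝ) ^ (-collisionCondEntropy (marginalCompl J (omega W p))) := by
  have hσ := isDensity_outputMean hW hp J
  have hP : ∀ y : (∀ j : {j // j ∉ J}, X j), 0 ≤ ∏ j : {j // j ∉ J}, p j (y j) :=
    fun y => Finset.prod_nonneg fun j _ => (hp j).1 _
  rw [sum_pairLaw_trace W p J same hJ, marginalCompl_omega,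
    collisionCondEntropy_cqState hP fun y => (hσ y).2, neg_neg, Real.rpow_logb two_pos (by simp)]
  have h1 : ∑ y : (∀ j : {j // j ∉ J}, X j), ∏ j : {j // j ∉ J}, p j (y j) = 1 :=
    sum_prod_eq_one (p := fun j : {j // j ∉ J} => p j) fun j => (hp j).2
  obtain ⟨y, -, hy⟩ := Finset.exists_ne_zero_of_sum_ne_zero (h1.trans_ne one_ne_zero)
  exact Finset.sum_pos' (fun y _ => mul_nonneg (hP y) (trace_sq_re_pos (hσ y)).le)
    ⟨y, Finset.mem_univ y, mul_pos ((hP y).lt_of_ne' hy) (trace_sq_re_pos (hσ y))⟩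

end Collision

/-! ### One-shot bounds -/

section OneShot

variable {K : ℕ} {X : Fin K → Type*} {d : Type*} [Fintype d] [DecidableEq d] {n : ℕ}

/-- The error of the simultaneous decoder is at most a missed detection and false alarms. -/
theorem avgError_simulDecoder_le {W : (∀ j, X j) → Matrix d d ℂ} {M : Fin K → ℕ}
    {Q : (∀ j, Fin n → X j) → Matrix (Fin n → d) (Fin n → d) ℂ} (hQ : IsTest Q)
    (hρ : ∀ x : (∀ j, Fin n → X j), (tensorOutput W x).PosSemidef) (c : Codebook X M n) :
    avgError W c (simulDecoder Q c) ≤ (∏ j, (M j : ℝ))⁻¹ * ∑ m : Msg M,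
      (2 * ((1 - Q (c.word m)) * tensorOutput W (c.word m)).trace.re +
        4 * ∑ m' ∈ Finset.univ.erase m, (Q (c.word m') * tensorOutput W (c.word m)).trace.re) := by
  refine mul_le_mul_of_nonneg_left (Finset.sum_le_sum fun m _ => ?_) (by positivity)
  -- S is the test of the sent tuple and T the sum of all competing tests.
  have h := hayashiNagaoka (hQ (c.word m)).1 (hQ (c.word m)).2
    (Matrix.posSemidef_sum (Finset.univ.erase m) fun m' _ => (hQ (c.word m')).1)
  rw [Finset.add_sum_erase _ (fun m' => Q (c.word m')) (Finset.mem_univ m)] at h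
  refine (trace_mul_re_mono h (hρ _)).trans_eq ?_
  rw [add_mul, Matrix.trace_add, Complex.add_re, Matrix.smul_mul, Matrix.smul_mul,
    Matrix.trace_smul, Matrix.trace_smul, Finset.sum_mul, Matrix.trace_sum, Complex.re_nsmul,
    Complex.re_nsmul, Complex.re_sum]
  simp

variable [∀ j, Fintype (X j)]

/-- By linearity, missed detection involves one random codeword tuple and each false alarm a pair,
whose joint law depends only on the set of senders with equal messages. -/
theorem expectedError_le_sum [∀ j, DecidableEq (X j)] {W : (∀ j, X j) → Matrix d d ℂ}
    {p : ∀ j, X j → ℝ} (hp : ∀ j, p j ∈ stdSimplex ℝ (X j)) {M : Fin K → ℕ}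
    {Q : (∀ j, Fin n → X j) → Matrix (Fin n → d) (Fin n → d) ℂ} (hQ : IsTest Q)
    (hρ : ∀ x : (∀ j, Fin n → X j), (tensorOutput W x).PosSemidef) :
    expectedError W p M Q ≤ (∏ j, (M j : ℝ))⁻¹ * ∑ m : Msg M,
      (2 * ∑ a : (∀ j, Fin n → X j),
          (∏ j, ∏ i, p j (a j i)) * ((1 - Q a) * tensorOutput W a).trace.re +
        4 * ∑ m' ∈ Finset.univ.erase m, ∑ a : (∀ j, Fin n → X j), ∑ b : (∀ j, Fin n → X j),
          (∏ j, ∏ i, pairLaw (m j = m' j) (p j) (a j i) (b j i)) *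
            (Q b * tensorOutput W a).trace.re) := by
  have hP : ∀ j, ∑ z : Fin n → X j, ∏ i, p j (z i) = 1 :=
    fun j => sum_prod_eq_one fun _ => (hp j).2
  have hw : ∀ c : Codebook X M n, 0 ≤ ∏ j, ∏ l, ∏ i, p j (c j l i) := fun c =>
    Finset.prod_nonneg fun j _ => Finset.prod_nonneg fun l _ => Finset.prod_nonneg fun i _ =>
      (hp j).1 _
  refine (Finset.sum_le_sum fun c _ => mul_le_mul_of_nonneg_left
    (avgError_simulDecoder_le hQ hρ c) (hw c)).trans_eq ?_
  have key := fun m m' : Msg M => sum_codebooks (M := M) hP m m'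
  simp only [pairLaw_prod] at key
  have h1 : ∀ m : Msg M, ∑ c : Codebook X M n, (∏ j, ∏ l, ∏ i, p j (c j l i)) *
      ((1 - Q (c.word m)) * tensorOutput W (c.word m)).trace.re =
      ∑ a : (∀ j, Fin n → X j),
          (∏ j, ∏ i, p j (a j i)) * ((1 - Q a) * tensorOutput W a).trace.re := by
    intro m
    refine (sum_codebooks (M := M) hP m m
      (fun a _ => ((1 - Q a) * tensorOutput W a).trace.re)).trans ?_
    simp only
    exact sum_pairLaw_self (P := fun j (z : Fin n → X j) => ∏ i, p j (z i))
      (fun a _ => ((1 - Q a) * tensorOutput W a).trace.re)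
  have h2 : ∀ m m' : Msg M, ∑ c : Codebook X M n, (∏ j, ∏ l, ∏ i, p j (c j l i)) *
      (Q (c.word m') * tensorOutput W (c.word m)).trace.re = _ :=
    fun m m' => key m m' (fun a b => (Q b * tensorOutput W a).trace.re)
  simp only [mul_left_comm _ (∏ j, (M j : ℝ))⁻¹]
  rw [← Finset.mul_sum]
  congr 1
  simp only [Finset.mul_sum]
  rw [Finset.sum_comm]
  refine Finset.sum_congr rfl fun m _ => ?_
  simp only [← Finset.mul_sum, ← h1 m, ← h2 m]
  rw [Finset.sum_comm, Finset.mul_sum, Finset.mul_sum, ← Finset.sum_add_distrib]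
  refine Finset.sum_congr rfl fun c _ => ?_
  rw [← Finset.mul_sum]
  ring

/-- A random codebook with small expected error contains a good code. -/
theorem exists_code_of_expectedError_le {W : (∀ j, X j) → Matrix d d ℂ}
    {p : ∀ j, X j → ℝ} (hp : ∀ j, p j ∈ stdSimplex ℝ (X j)) {M : Fin K → ℕ} (hM : ∀ j, 0 < M j)
    {Q : (∀ j, Fin n → X j) → Matrix (Fin n → d) (Fin n → d) ℂ} (hQ : IsTest Q)
    (hρ : ∀ x : (∀ j, Fin n → X j), (tensorOutput W x).PosSemidef) {ε : ℝ}
    (hε : expectedError W p M Q ≤ ε) :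
    ∃ C : MACCode X d M n, C.UsesSimulDecoder Q ∧ avgError W C.codebook C.povm ≤ ε := by
  have hw : ∀ c : Codebook X M n, 0 ≤ ∏ j, ∏ l, ∏ i, p j (c j l i) := fun c =>
    Finset.prod_nonneg fun j _ => Finset.prod_nonneg fun l _ => Finset.prod_nonneg fun i _ =>
      (hp j).1 _
  have hw1 : ∑ c : Codebook X M n, ∏ j, ∏ l, ∏ i, p j (c j l i) = 1 :=
    sum_prod_eq_one fun j => sum_prod_eq_one fun l => sum_prod_eq_one fun i => (hp j).2
  obtain ⟨c, hc⟩ : ∃ c : Codebook X M n, avgError W c (simulDecoder Q c) ≤ ε := by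
    by_contra! h
    have hlt : ∑ c : Codebook X M n, (∏ j, ∏ l, ∏ i, p j (c j l i)) * ε <
        ∑ c : Codebook X M n,
          (∏ j, ∏ l, ∏ i, p j (c j l i)) * avgError W c (simulDecoder Q c) := by
      obtain ⟨c, -, hc⟩ := Finset.exists_ne_zero_of_sum_ne_zero (hw1.trans_ne one_ne_zero)
      exact Finset.sum_lt_sum (fun c _ => mul_le_mul_of_nonneg_left (h c).le (hw c))
        ⟨c, Finset.mem_univ c, mul_lt_mul_of_pos_left (h c) ((hw c).lt_of_ne' hc)⟩
    rw [← Finset.sum_mul, hw1, one_mul] at hlt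
    exact absurd hε (not_le.2 hlt)
  set S := ∑ m' : Msg M, Q (c.word m') with hS
  have hSpos : S.PosSemidef := Matrix.posSemidef_sum _ fun m' _ => (hQ _).1
  have hsum : ∑ m : Msg M, simulDecoder Q c m = invSqrt S * S * invSqrt S := by
    simp only [simulDecoder]
    rw [← Finset.sum_mul, ← Finset.mul_sum]
  obtain ⟨hdec, hrest⟩ : (∀ m, (simulDecoder Q c m).PosSemidef) ∧
      (1 - ∑ m : Msg M, simulDecoder Q c m).PosSemidef := by
    obtain ⟨U, v, hv⟩ := exists_eq_conjDiagonal hSpos.1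
    have hv0 : ∀ i, 0 ≤ v i := nonneg_of_posSemidef_conjDiagonal (hv ▸ hSpos)
    have hR : invSqrt S = conjDiagonal U (fun i => (√(v i))⁻¹) := by
      rw [hv, invSqrt, cfc_conjDiagonal]
    constructor
    · intro m
      have := (hQ (c.word m)).1.mul_mul_conjTranspose_same (invSqrt S)
      rwa [hR, (isHermitian_conjDiagonal U _).eq, ← hR] at this
    · rw [hsum, hR, hv, ← map_one (conjDiagonal U), ← map_mul, ← map_mul, ← map_sub]
      refine posSemidef_conjDiagonal U fun i => ?_
      simp only [Pi.sub_apply, Pi.one_apply, Pi.mul_apply, sub_nonneg]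
      rcases (hv0 i).eq_or_lt with h | h
      · simp [← h]
      · rw [mul_comm, ← mul_assoc, ← mul_inv, Real.mul_self_sqrt h.le, inv_mul_cancel₀ h.ne']
  -- The unused part of the identity is given to an arbitrary outcome; enlarging POVM elements
  -- cannot increase the error.
  let m₀ : Msg M := fun j => ⟨0, hM j⟩
  have hextra : ∀ m, (if m = m₀ then 1 - ∑ m : Msg M, simulDecoder Q c m else 0).PosSemidef := by
    intro m
    split_ifs
    · exact hrest
    · exact Matrix.PosSemidef.zero
  let C : MACCode X d M n :=
    { codebook := c
      povm := fun m => simulDecoder Q c m +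
        if m = m₀ then 1 - ∑ m : Msg M, simulDecoder Q c m else 0
      povm_posSemidef := fun m => (hdec m).add (hextra m)
      povm_sum := by
        rw [Finset.sum_add_distrib, Finset.sum_ite_eq' Finset.univ m₀]
        simp }
  have hC : C.UsesSimulDecoder Q := fun m => by
    simpa only [C, add_sub_cancel_left] using hextra m
  refine ⟨C, hC, le_trans ?_ hc⟩
  refine mul_le_mul_of_nonneg_left (Finset.sum_le_sum fun m _ => ?_) (by positivity)
  refine trace_mul_re_mono ?_ (hρ _)
  rw [sub_sub_sub_cancel_left]
  exact hC m

end OneShot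

/-! ### Achievability -/

/-- By convexity (1+x)^K lies below its chord on [0,1]. The bound makes the union bound linear in x.
-/
theorem one_add_pow_sub_one_le (K : ℕ) {x : ℝ} (h0 : 0 ≤ x) (h1 : x ≤ 1) :
    (1 + x) ^ K - 1 ≤ (2 ^ K - 1) * x := by
  induction K with
  | zero => simp
  | succ K ih =>
    have h2 : (1 : ℝ) ≤ 2 ^ K := one_le_pow₀ one_le_two
    have h3 : 0 ≤ ((2 : ℝ) ^ K - 1) * x := mul_nonneg (by linarith) h0
    have h4 : (1 + x) * ((1 + x) ^ K - 1) ≤ 2 * ((2 ^ K - 1) * x) :=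
      mul_le_mul (by linarith) ih (sub_nonneg.2 (one_le_pow₀ (by linarith))) two_pos.le
    rw [pow_succ, pow_succ]
    linarith

/-- A union bound over all message tuples different from `m`, where each differing message of
sender `j` contributes a factor `t j`. -/
theorem sum_erase_prod_ite {K : ℕ} {M : Fin K → ℕ} (t : Fin K → ℝ) (m : Msg M) :
    ∑ m' ∈ Finset.univ.erase m, ∏ j, (if m j = m' j then 1 else t j) =
      ∏ j, (1 + (M j - 1) * t j) - 1 := by
  rw [eq_sub_iff_add_eq, add_comm]
  -- Restoring the term m' = m, which is 1, makes the sum run over a full product and hence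
  -- factorize.
  have h1 : ∏ j, (if m j = m j then 1 else t j) = 1 := by simp
  nth_rw 1 [← h1]
  rw [Finset.add_sum_erase _ (fun m' : Msg M => ∏ j, (if m j = m' j then 1 else t j))
    (Finset.mem_univ m), ← Fintype.prod_sum (fun j l => if m j = l then 1 else t j)]
  refine Finset.prod_congr rfl fun j _ => ?_
  rw [← Finset.add_sum_erase _ _ (Finset.mem_univ (m j)), if_pos rfl,
    Finset.sum_congr rfl fun l hl => if_neg (Finset.ne_of_mem_erase hl).symm]
  have := (m j).pos
  simp [Finset.card_erase_of_mem, Nat.cast_sub (Nat.one_le_iff_ne_zero.2 this.ne')]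

/-! ### The spectral threshold test and its two error probabilities -/

section Test

variable {K : ℕ} {X : Fin K → Type*} {d : Type*} [Fintype d] [DecidableEq d]

/-- The spectral projection of the output for the input words `x` onto the eigenvalues which are at
least `τ ^ n`, where the channel outputs have eigenbases `U` and eigenvalues `v`. -/
def thresholdTest (U : (∀ j, X j) → unitary (Matrix d d ℂ)) (v : (∀ j, X j) → d → ℝ) (τ : ℝ)
    {n : ℕ} (x : ∀ j, Fin n → X j) : Matrix (Fin n → d) (Fin n → d) ℂ :=
  conjDiagonal (tensorUnitary fun i => U fun j => x j i)
    (fun k => if 1 ≤ ∏ i, v (fun j => x j i) (k i) / τ then 1 else 0)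

variable {U : (∀ j, X j) → unitary (Matrix d d ℂ)} {v : (∀ j, X j) → d → ℝ} {τ : ℝ} {n : ℕ}

theorem isTest_thresholdTest : IsTest (thresholdTest U v τ (n := n)) := by
  refine fun x => ⟨posSemidef_conjDiagonal _ fun k => by split_ifs <;> norm_num, ?_⟩
  rw [thresholdTest, ← map_one (conjDiagonal _), ← map_sub]
  refine posSemidef_conjDiagonal _ fun k => ?_
  simp only [Pi.sub_apply, Pi.one_apply]
  split_ifs <;> norm_num

variable {W : (∀ j, X j) → Matrix d d ℂ}

theorem tensorOutput_eq_conjDiagonal (hW : ∀ x, W x = conjDiagonal (U x) (v x))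
    (x : ∀ j, Fin n → X j) :
    tensorOutput W x = conjDiagonal (tensorUnitary fun i => U fun j => x j i)
      (fun k => ∏ i, v (fun j => x j i) (k i)) := by
  rw [conjDiagonal_tensorUnitary]
  simp only [← hW]
  rfl

theorem trace_one_sub_thresholdTest_mul (hW : ∀ x, W x = conjDiagonal (U x) (v x))
    (x : ∀ j, Fin n → X j) :
    ((1 - thresholdTest U v τ x) * tensorOutput W x).trace.re =
      ∑ k : Fin n → d, (∏ i, v (fun j => x j i) (k i)) *
        (if 1 ≤ ∏ i, v (fun j => x j i) (k i) / τ then 0 else 1) := by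
  rw [tensorOutput_eq_conjDiagonal hW, thresholdTest, ← map_one (conjDiagonal _), ← map_sub,
    ← map_mul, trace_conjDiagonal, Complex.ofReal_re]
  refine Finset.sum_congr rfl fun k _ => ?_
  simp only [Pi.mul_apply, Pi.sub_apply, Pi.one_apply]
  split_ifs <;> ring

/-- Test and state share an eigenbasis, and every retained eigenvalue is at least τ^n. This lets a
false alarm be bounded by an overlap of two states. -/
theorem posSemidef_smul_tensorOutput_sub_thresholdTest
    (hW : ∀ x, W x = conjDiagonal (U x) (v x)) (hv : ∀ x i, 0 ≤ v x i) (hτ : 0 < τ)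
    (x : ∀ j, Fin n → X j) :
    ((τ ^ n)⁻¹ • tensorOutput W x - thresholdTest U v τ x).PosSemidef := by
  rw [tensorOutput_eq_conjDiagonal hW, thresholdTest, ← map_smul, ← map_sub]
  refine posSemidef_conjDiagonal _ fun k => ?_
  have h : (τ ^ n)⁻¹ * ∏ i, v (fun j => x j i) (k i) = ∏ i, v (fun j => x j i) (k i) / τ := by
    rw [Finset.prod_div_distrib, div_eq_inv_mul]
    simp
  simp only [Pi.sub_apply, Pi.smul_apply, smul_eq_mul, h, sub_nonneg]
  split_ifs with h1
  · exact h1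
  · exact Finset.prod_nonneg fun i _ => div_nonneg (hv _ _) hτ.le

/-- The false alarm probability of the threshold test, for letters of which some are shared. -/
theorem sum_pairLaw_thresholdTest_le [∀ j, Fintype (X j)] [∀ j, DecidableEq (X j)]
    (hW : ∀ x, W x = conjDiagonal (U x) (v x)) (hv : ∀ x i, 0 ≤ v x i) (hτ : 0 < τ)
    {p : ∀ j, X j → ℝ} (hp : ∀ j x, 0 ≤ p j x) (same : Fin K → Prop) [∀ j, Decidable (same j)] :
    ∑ a : (∀ j, Fin n → X j), ∑ b : (∀ j, Fin n → X j),
        (∏ j, ∏ i, pairLaw (same j) (p j) (a j i) (b j i)) *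
          (thresholdTest U v τ b * tensorOutput W a).trace.re ≤
      (τ⁻¹ * ∑ a, ∑ b, (∏ j, pairLaw (same j) (p j) (a j) (b j)) * (W b * W a).trace.re) ^ n := by
  have hpl : ∀ j x y, 0 ≤ pairLaw (same j) (p j) x y := by
    intro j x y
    unfold pairLaw
    split_ifs
    exacts [hp j x, le_rfl, mul_nonneg (hp j x) (hp j y)]
  have hρ : ∀ x : (∀ j, Fin n → X j), (tensorOutput W x).PosSemidef := fun x => by
    rw [tensorOutput_eq_conjDiagonal hW]
    exact posSemidef_conjDiagonal _ fun k => Finset.prod_nonneg fun i _ => hv _ _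
  -- The trace of a product of two Hermitian operators is real, so taking real parts commutes with
  -- the product over letters.
  have hre : ∀ x y, (((W y * W x).trace.re : ℝ) : ℂ) = (W y * W x).trace := by
    intro x y
    have hH : ∀ z, (W z).conjTranspose = W z := fun z => by
      rw [hW]
      exact (isHermitian_conjDiagonal _ _).eq
    rw [← Complex.conj_eq_iff_re, ← Complex.star_def, ← Matrix.trace_conjTranspose,
      Matrix.conjTranspose_mul, hH, hH, Matrix.trace_mul_comm]
  have htr : ∀ a b : (∀ j, Fin n → X j), (tensorOutput W b * tensorOutput W a).trace.re =
      ∏ i, (W (fun j => b j i) * W (fun j => a j i)).trace.re := by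
    intro a b
    have : (tensorOutput W b * tensorOutput W a).trace =
        ∏ i, (W (fun j => b j i) * W (fun j => a j i)).trace :=
      (congrArg Matrix.trace (piTensor_mul _ _)).trans (trace_piTensor _)
    rw [this, Finset.prod_congr rfl fun i _ => (hre _ _).symm, ← Complex.ofReal_prod,
      Complex.ofReal_re]
  rw [mul_pow, ← sum_sum_prod_eq_pow, Finset.mul_sum]
  refine Finset.sum_le_sum fun a _ => ?_
  rw [Finset.mul_sum]
  refine Finset.sum_le_sum fun b _ => ?_
  rw [mul_left_comm]
  refine mul_le_mul_of_nonneg_left ?_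
    (Finset.prod_nonneg fun j _ => Finset.prod_nonneg fun i _ => hpl j _ _)
  refine (trace_mul_re_mono
    (posSemidef_smul_tensorOutput_sub_thresholdTest hW hv hτ b) (hρ a)).trans_eq ?_
  rw [Matrix.smul_mul, Matrix.trace_smul, Complex.smul_re, htr, smul_eq_mul, inv_pow]

/-- The missed detection probability of the threshold test is exponentially small, if the threshold
is below the typical eigenvalues. -/
theorem exists_sum_one_sub_thresholdTest_le [∀ j, Fintype (X j)] [∀ j, DecidableEq (X j)]
    (hW : ∀ x, W x = conjDiagonal (U x) (v x)) (hv : ∀ x i, 0 ≤ v x i)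
    (hv1 : ∀ x, ∑ i, v x i = 1) {p : ∀ j, X j → ℝ} (hp : ∀ j, p j ∈ stdSimplex ℝ (X j))
    (hτ : 0 < τ) (hτ' : Real.logb 2 τ < -condEntropy (omega W p)) :
    ∃ r : ℝ, 0 ≤ r ∧ r < 1 ∧ ∀ n : ℕ, ∑ a : (∀ j, Fin n → X j), (∏ j, ∏ i, p j (a j i)) *
      ((1 - thresholdTest U v τ a) * tensorOutput W a).trace.re ≤ r ^ n := by
  -- Joint law of the input letters and an eigenvalue index; under it -log₂ v has mean H(C|X_1⋯X_K).
  set P : (∀ j, X j) × d → ℝ := fun u => (∏ j, p j (u.1 j)) * v u.1 u.2 with hP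
  have hp1 : ∑ x : (∀ j, X j), ∏ j, p j (x j) = 1 := sum_prod_eq_one fun j => (hp j).2
  have hP0 : ∀ u, 0 ≤ P u :=
    fun u => mul_nonneg (Finset.prod_nonneg fun j _ => (hp j).1 _) (hv _ _)
  have hP1 : ∑ u, P u = 1 := by
    simp [hP, Fintype.sum_prod_type, ← Finset.mul_sum, hv1, hp1]
  have hpos : ∀ u, P u ≠ 0 → 0 < v u.1 u.2 := fun u hu =>
    (hv _ _).lt_of_ne' (right_ne_zero_of_mul hu)
  have hent : -condEntropy (omega W p) = ∑ u, P u * Real.logb 2 (v u.1 u.2) := by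
    rw [omega, show W = fun x => conjDiagonal (U x) (v x) from funext hW,
      condEntropy_cqState _ U hv1, neg_neg, Fintype.sum_prod_type]
  have hmean : 0 < ∑ u, P u * Real.log (v u.1 u.2 / τ) := by
    have h1 : ∀ u, P u * Real.log (v u.1 u.2 / τ) =
        (P u * Real.logb 2 (v u.1 u.2) - P u * Real.logb 2 τ) * Real.log 2 := by
      intro u
      have h2 : Real.log 2 ≠ 0 := (Real.log_pos one_lt_two).ne'
      by_cases hu : P u = 0
      · simp [hu]
      · rw [Real.log_div (hpos u hu).ne' hτ.ne', Real.logb, Real.logb]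
        field_simp
    rw [Finset.sum_congr rfl fun u _ => h1 u, ← Finset.sum_mul, Finset.sum_sub_distrib,
      ← Finset.sum_mul, hP1, one_mul, ← hent]
    exact mul_pos (sub_pos.2 hτ') (Real.log_pos one_lt_two)
  obtain ⟨r, hr0, hr1, hr⟩ := exists_tail_le_pow hP0 hP1
    (fun u hu => div_pos (hpos u hu) hτ) hmean
  refine ⟨r, hr0, hr1, fun n => le_trans (le_of_eq ?_) (hr n)⟩
  rw [sum_piComm, ← (Equiv.arrowProdEquivProdArrow (Fin n) _ _).symm.sum_comp,
    Fintype.sum_prod_type]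
  refine Finset.sum_congr rfl fun a _ => ?_
  rw [trace_one_sub_thresholdTest_mul hW, Finset.mul_sum]
  refine Finset.sum_congr rfl fun k _ => ?_
  simp only [hP, Equiv.arrowProdEquivProdArrow, Equiv.coe_fn_symm_mk, Finset.prod_mul_distrib]
  rw [Finset.prod_comm, mul_assoc]
  rfl

end Test

-- The slack δ is split: half of it puts the threshold strictly below the typical eigenvalues, and
-- the other half makes the union bound decay.
open Filter Topology in
theorem simulAchievable_of_sum_le {K : ℕ} {X : Fin K → Type*} [∀ j, Fintype (X j)]
    [∀ j, DecidableEq (X j)] {d : Type*} [Fintype d] [DecidableEq d]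
    {W : (∀ j, X j) → Matrix d d ℂ} (hW : ∀ x, IsDensity (W x))
    {p : ∀ j, X j → ℝ} (hp : ∀ j, p j ∈ stdSimplex ℝ (X j)) {R : Fin K → ℝ}
    (hR : ∀ J : Finset (Fin K), J.Nonempty → ∑ j ∈ J, R j ≤ infoPrime (omega W p) J) :
    SimulAchievable W p R := by
  intro ε hε _ δ hδ
  choose U v hWU hv hv1 using fun x => (hW x).exists_eq_conjDiagonal
  set H := condEntropy (omega W p) with hH
  set τ : ℝ := 2 ^ (-(H + δ / 2)) with hτdef
  have hτ : 0 < τ := Real.rpow_pos_of_pos two_pos _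
  have hτ' : Real.logb 2 τ < -H := by
    rw [hτdef, Real.logb_rpow two_pos (by norm_num)]
    linarith
  obtain ⟨r, hr0, hr1, hr⟩ := exists_sum_one_sub_thresholdTest_le hWU hv hv1 hp hτ hτ'
  set s : ℝ := 2 ^ (-(δ / 2)) with hs
  have hs0 : 0 < s := Real.rpow_pos_of_pos two_pos _
  have hs1 : s < 1 := Real.rpow_lt_one_of_one_lt_of_neg one_lt_two (by linarith)
  have hlim : Tendsto (fun n : ℕ => 2 * r ^ n + 4 * ((2 ^ K - 1) * s ^ n)) atTop (𝓝 0) := by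
    have h1 := (tendsto_pow_atTop_nhds_zero_of_lt_one hr0 hr1).const_mul 2
    have h2 := ((tendsto_pow_atTop_nhds_zero_of_lt_one hs0.le hs1).const_mul
      ((2 : ℝ) ^ K - 1)).const_mul 4
    simpa using h1.add h2
  obtain ⟨N, hN⟩ := eventually_atTop.1 (hlim.eventually (gt_mem_nhds hε))
  refine ⟨N, fun n hn => ?_⟩
  set M := numMessages R δ n with hM
  have hMpos : ∀ j, 0 < M j := fun j => Nat.ceil_pos.2 (Real.rpow_pos_of_pos two_pos _)
  have hρ : ∀ x : (∀ j, Fin n → X j), (tensorOutput W x).PosSemidef := fun x => by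
    rw [tensorOutput_eq_conjDiagonal hWU]
    exact posSemidef_conjDiagonal _ fun k => Finset.prod_nonneg fun i _ => hv _ _
  have hQ : IsTest (thresholdTest U v τ (n := n)) := isTest_thresholdTest
  -- the false alarm probability for a single message tuple
  have hfalse : ∀ m m' : Msg M, m' ∈ Finset.univ.erase m →
      ∑ a : (∀ j, Fin n → X j), ∑ b : (∀ j, Fin n → X j),
        (∏ j, ∏ i, pairLaw (m j = m' j) (p j) (a j i) (b j i)) *
          (thresholdTest U v τ b * tensorOutput W a).trace.re ≤
        (2 : ℝ) ^ (n * (δ / 2)) *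
          ∏ j, (if m j = m' j then 1 else (2 : ℝ) ^ (-(n * R j))) := by
    intro m m' hm
    -- The senders whose messages differ; the rate condition for exactly this set controls the pair.
    set J : Finset (Fin K) := Finset.univ.filter fun j => ¬ m j = m' j with hJ
    have hJne : J.Nonempty := by
      obtain ⟨j, hj⟩ := Function.ne_iff.1 (Finset.ne_of_mem_erase hm)
      exact ⟨j, by simpa [hJ] using Ne.symm hj⟩
    refine (sum_pairLaw_thresholdTest_le hWU hv hτ (fun j => (hp j).1)
      (fun j => m j = m' j)).trans ?_
    rw [sum_pairLaw_trace_eq_rpow hW hp J (fun j => m j = m' j) (by simp [hJ]), hτdef,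
      ← Real.rpow_neg two_pos.le, ← Real.rpow_add two_pos, ← Real.rpow_mul_natCast two_pos.le]
    have hprod : ∏ j, (if m j = m' j then 1 else (2 : ℝ) ^ (-(n * R j))) =
        2 ^ (-(n * ∑ j ∈ J, R j)) := by
      rw [Finset.mul_sum, ← Finset.sum_neg_distrib, Real.rpow_sum_of_pos two_pos, hJ,
        Finset.prod_filter]
      refine Finset.prod_congr rfl fun j _ => ?_
      split_ifs <;> simp_all
    rw [hprod, ← Real.rpow_add two_pos]
    refine Real.rpow_le_rpow_of_exponent_le one_le_two ?_
    have h1 := mul_le_mul_of_nonneg_left (hR J hJne) (Nat.cast_nonneg (α := ℝ) n)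
    rw [infoPrime, ← hH] at h1
    linarith
  have hcount : ∀ m : Msg M, (2 : ℝ) ^ (n * (δ / 2)) * ∑ m' ∈ Finset.univ.erase m,
      ∏ j, (if m j = m' j then 1 else (2 : ℝ) ^ (-(n * R j))) ≤ (2 ^ K - 1) * s ^ n := by
    intro m
    set x : ℝ := 2 ^ (-(n * δ)) with hx
    have hx0 : 0 < x := Real.rpow_pos_of_pos two_pos _
    have hx1 : x ≤ 1 := Real.rpow_le_one_of_one_le_of_nonpos one_le_two
      (neg_nonpos.2 (mul_nonneg (Nat.cast_nonneg _) hδ.le))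
    have hMx : ∀ j, 0 ≤ ((M j : ℝ) - 1) * (2 : ℝ) ^ (-(n * R j)) ∧
        ((M j : ℝ) - 1) * (2 : ℝ) ^ (-(n * R j)) ≤ x := by
      intro j
      have h1 : (1 : ℝ) ≤ M j := by exact_mod_cast hMpos j
      -- Only the M_j - 1 wrong messages count, which exactly absorbs the rounding up, even when R_j
      -- < δ.
      have h2 : (M j : ℝ) - 1 ≤ (2 : ℝ) ^ ((n : ℝ) * (R j - δ)) := by
        have := Nat.ceil_lt_add_one (Real.rpow_pos_of_pos two_pos ((n : ℝ) * (R j - δ))).le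
        rw [hM, numMessages]
        linarith
      have h3 : (0 : ℝ) < (2 : ℝ) ^ (-(n * R j)) := Real.rpow_pos_of_pos two_pos _
      refine ⟨mul_nonneg (by linarith) h3.le, (mul_le_mul_of_nonneg_right h2 h3.le).trans_eq ?_⟩
      rw [← Real.rpow_add two_pos, hx]
      congr 1
      ring
    have h4 : ∏ j, (1 + ((M j : ℝ) - 1) * (2 : ℝ) ^ (-(n * R j))) ≤ (1 + x) ^ K := by
      refine (Finset.prod_le_prod (fun j _ => by linarith [(hMx j).1])
        fun j _ => add_le_add_right (hMx j).2 1).trans_eq ?_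
      simp
    rw [sum_erase_prod_ite]
    refine (mul_le_mul_of_nonneg_left ((sub_le_sub_right h4 1).trans
      (one_add_pow_sub_one_le K hx0.le hx1)) (Real.rpow_pos_of_pos two_pos _).le).trans_eq ?_
    rw [mul_left_comm, hx, ← Real.rpow_add two_pos, hs, ← Real.rpow_mul_natCast two_pos.le]
    congr 2
    ring
  have hexp : expectedError W p M (thresholdTest U v τ (n := n)) ≤ ε := by
    refine (expectedError_le_sum hp hQ hρ).trans ?_
    have hMprod : (0 : ℝ) < ∏ j, (M j : ℝ) := Finset.prod_pos fun j _ => by exact_mod_cast hMpos j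
    rw [inv_mul_le_iff₀ hMprod]
    refine (Finset.sum_le_sum fun m _ => (add_le_add
      (mul_le_mul_of_nonneg_left (hr n) two_pos.le)
      (mul_le_mul_of_nonneg_left (((Finset.sum_le_sum (hfalse m)).trans_eq
        (Finset.mul_sum _ _ _).symm).trans (hcount m)) zero_le_four)).trans (hN n hn).le).trans_eq ?_
    simp
  exact ⟨_, hQ, hexp, exists_code_of_expectedError_le hp hMpos hQ hρ hexp⟩

end QMAC

end

theorem mainTheorem8 {K : ℕ} {X : Fin K → Type*} [∀ j, Fintype (X j)]
    [∀ j, DecidableEq (X j)] {d : Type*} [Fintype d] [DecidableEq d]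
    (W : (∀ j, X j) → Matrix d d ℂ) (hW : ∀ x, QMAC.IsDensity (W x))
    (p : ∀ j, X j → ℝ) (hp : ∀ j, p j ∈ stdSimplex ℝ (X j)) :
    (∀ R : Fin K → ℝ, (∀ j, 0 ≤ R j) →
      (∀ J : Finset (Fin K), J.Nonempty →
        ∑ j ∈ J, R j ≤ QMAC.infoPrime (QMAC.omega W p) J) →
      QMAC.SimulAchievable W p R) ∧
    (∀ (Y : Type*) (A : Type*) [Fintype Y] [DecidableEq Y] [Fintype A] [DecidableEq A]
      (q : Y → ℝ) (σ : Y → Matrix A A ℂ),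
      q ∈ stdSimplex ℝ Y → (∀ y, QMAC.IsDensity (σ y)) →
      QMAC.collisionCondEntropy (QMAC.cqState q σ) =
        -Real.logb 2 (∑ y, q y * (σ y * σ y).trace.re)) := by
  exact ⟨fun R _ hR => QMAC.simulAchievable_of_sum_le hW hp hR,
    fun Y A _ _ _ _ q σ hq hσ => QMAC.collisionCondEntropy_cqState hq.1 fun y => (hσ y).2⟩
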